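/- Let $k\ge 1$ and $d\ge 0$ be integers, and write $[n]=\{1,\dots,n\}$. All graphs are finite, simple and undirected, and graphs are considered up to isomorphism. **Bilabelled graphs and covers.** A $(k+d,k+d)$-bilabelled graph is a triple $\boldsymbol F=(F,\vec u,\vec v)$ with $F$ a graph and $\vec u,\vec v\in V(F)^{k+d}$ (in-labels and out-labels). The series composition $\boldsymbol F\cdot\boldsymbol F'$ of $(F,\vec u,\vec v)$ and $(F',\vec u',\vec v')$ is the disjoint union of $F$ and $F'$ with $\vec v_i$ and $\vec u'_i$ identified for all $i$ (as a simple graph), in-labels $\vec u$ and out-labels $\vec v'$. A tree cover of $F$ is a partial order $\le$ on $V(F)$ with a least element (root), in which the predecessors of each vertex form a finite chain, and such that the endpoints of each edge are comparable; a leaf is a vertex whose only successor is itself. A $(k+1)$-pebbling function is a map $p:V(F)\to[k+1]$ such that whenever $x\le y$ and $xy\in E(F)$, one has $p(z)\ne p(x)$ for all $z\neq x$ with $x\le z\le y$. **The set $\mathcal{WL}_k^d$.** It consists of a symbol $\bot$ and of all tuples $\widehat{\boldsymbol F}=(\boldsymbol F,p_{\rm in},p_{\rm out})$, where $\boldsymbol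 F=(F,\vec u,\vec v)$ is a $(k+d,k+d)$-bilabelled graph and $p_{\rm in},p_{\rm out}:[k+d]\to[k+1]$, for which there exist a tree cover of $F$ and a $(k+1)$-pebbling function $p$ for it such that: - (B1) $\vec u_1=\vec v_1$ is the root, and $\vec u_{k+d}$ and $\vec v_{k+d}$ are leaves; - (B2) $\vec u_i=\vec v_i$ for $i\in[k]$, $\vec u_1\le\dots\le\vec u_{k+d}$ and $\vec v_1\le\dots\le\vec v_{k+d}$; - (B3) for $k\le i<k+d$: $\vec u_i<\vec u_{i+1}$ and $\vec v_i<\vec v_{i+1}$, and no vertex lies strictly between $\vec u_i$ and $\vec u_{i+1}$ or strictly between $\vec v_i$ and $\vec v_{i+1}$; - (B4) every unlabelled vertex $x$ satisfies $\vec u_k\le x$; - (B5) for every leaf $x$, $|\{y:\vec u_k<y\le x\}|=d$; - (B6) with $\mathrm{gca}(x,y)=|\{z:\vec u_k<z,\ z\le x,\ z\le y\}|$, one has $\mathrm{gca}(x,y)\ge\mathrm{gca}(\vec u_{k+d},\vec v_{k+d})$ for all leaves $x,y$; - (B7) $p$ is injective on $\{\vec u_1,\dots,\vec u_k\}$; -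 (B8) $p_{\rm in}(i)=p(\vec u_i)$ and $p_{\rm out}(i)=p(\vec v_i)$ for all $i\in[k+d]$. The series composition of $(\boldsymbol F,p_{\rm in},p_{\rm out})$ and $(\boldsymbol F',p'_{\rm in},p'_{\rm out})$ is $(\boldsymbol F\cdot\boldsymbol F',p_{\rm in},p'_{\rm out})$ if $p_{\rm out}=p'_{\rm in}$ and $\bot$ otherwise; a series composition with $\bot$ on either side is $\bot$. **The generators $\mathcal A_k^d$.** Let $H\subseteq[k]$, let $\vec h\in H^k$ be nondecreasing with set of entries exactly $H$, and put $V=H\cup\{k+1,\dots,k+d\}$ and $\vec w=\vec h_1\cdots\vec h_k(k+1)\cdots(k+d)$. Call $p:[k+d]\to[k+1]$ compatible with $\vec h$ if $p(a)=p(b)\iff\vec h_a=\vec h_b$ for all $a,b\in[k]$; such a $p$ assigns to each vertex of $V$ the common value of $p$ at the labels located there. The set $\mathcal A_k^d$ consists of the following elements, for all such $H,\vec h$: 1. the identity graphs $((I,\vec w,\vec w),p,p)$ with $V(I)=V$, $E(I)=\emptyset$ and $p$ compatible; 2. the adjacency graphs $((A^{ij},\vec w,\vec w),p,p)$ with $V(A^{ij})=V$,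 $E(A^{ij})=\{ij\}$, $i<j$ in $V$, and $p$ compatible such that the value assigned to the vertex $i$ differs from the value assigned to each vertex $\ell\in V$ with $i<\ell\le j$; 3. the join graphs $((J^\ell,\vec w,\vec w'),p_{\rm in},p_{\rm out})$ for $k\le\ell<k+d$, with $V(J^\ell)=V\cup\{(\ell+1)',\dots,(k+d)'\}$, $E(J^\ell)=\emptyset$, $\vec w'_i=\vec w_i$ for $i\le\ell$ and $\vec w'_i=i'$ for $i>\ell$, $p_{\rm in}$ compatible, and $p_{\rm in}(i)=p_{\rm out}(i)$ for all $i\le\ell$. **Proposition.** For every $\widehat{\boldsymbol F}\in\mathcal{WL}_k^d$ there are $r\ge 1$ and $\widehat{\boldsymbol A}^1,\dots,\widehat{\boldsymbol A}^r\in\mathcal A_k^d$ such that $\widehat{\boldsymbol F}=\widehat{\boldsymbol A}^1\cdot\ldots\cdot\widehat{\boldsymbol A}^r$ (up to isomorphism of bilabelled graphs, with equal pebbling data). -/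

import Mathlib

universe u v

namespace PebbleWL

/-! ### Bilabelled graphs -/

/-- An `(m, n)`-bilabelled graph: a finite simple undirected graph with an `m`-tuple of in-labelled
vertices and an `n`-tuple of out-labelled vertices. -/
structure BilabelledGraph (m n : ℕ) : Type (u + 1) where
  V : Type u
  finite_V : Finite V
  graph : SimpleGraph V
  inLabel : Fin m → V
  outLabel : Fin n → V

/-- Isomorphism of bilabelled graphs: a graph isomorphism preserving both label tuples. -/
def BilabelledGraph.Iso {m n : ℕ} (F : BilabelledGraph.{u} m n) (F' : BilabelledGraph.{v} m n) :
    Prop :=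
  ∃ e : F.graph ≃g F'.graph,
    (∀ i, e (F.inLabel i) = F'.inLabel i) ∧ (∀ i, e (F.outLabel i) = F'.outLabel i)

/-- The identifications of a series composition: the `i`-th out-label of `F` with the `i`-th
in-label of `F'`. `Quot` of this relation is the quotient by the generated equivalence relation. -/
def BilabelledGraph.Glue {l m n : ℕ} (F : BilabelledGraph.{u} l m) (F' : BilabelledGraph.{u} m n)
    (x y : F.V ⊕ F'.V) : Prop :=
  ∃ i : Fin m, x = Sum.inl (F.outLabel i) ∧ y = Sum.inr (F'.inLabel i)

/-- Series composition of bilabelled graphs: the disjoint union with the out-labels of `F` identified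
with the in-labels of `F'`, as a simple graph (parallel edges are merged, and loops discarded). -/
def BilabelledGraph.series {l m n : ℕ} (F : BilabelledGraph.{u} l m)
    (F' : BilabelledGraph.{u} m n) : BilabelledGraph.{u} l n where
  V := Quot (F.Glue F')
  finite_V := by
    have := F.finite_V
    have := F'.finite_V
    infer_instance
  graph :=
    { Adj := fun a b => a ≠ b ∧ ∃ x y : F.V ⊕ F'.V,
        Quot.mk _ x = a ∧ Quot.mk _ y = b ∧ (F.graph.sum F'.graph).Adj x y
      symm := ⟨fun _ _ ⟨hne, x, y, hx, hy, hxy⟩ => ⟨hne.symm, y, x, hy, hx, hxy.symm⟩⟩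
      loopless := ⟨fun _ h => h.1 rfl⟩ }
  inLabel := fun i => Quot.mk _ (Sum.inl (F.inLabel i))
  outLabel := fun i => Quot.mk _ (Sum.inr (F'.outLabel i))

/-! ### Tree covers and pebbling functions -/

/-- A poset is a forest if the predecessors of every element form a finite chain. -/
def IsForest (P : Type u) [PartialOrder P] : Prop :=
  ∀ x : P, (Set.Iic x).Finite ∧ IsChain (· ≤ ·) (Set.Iic x)

/-- A tree is a forest with a root. -/
def IsTree (P : Type u) [PartialOrder P] : Prop :=
  IsForest P ∧ ∃ r : P, ∀ y : P, r ≤ y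

/-- A leaf is an element whose only successor is itself. -/
def IsLeaf {P : Type u} [PartialOrder P] (x : P) : Prop :=
  {y : P | x ≤ y} = {x}

/-- The order on the vertex set is a tree cover of `G`: it is a tree and the endvertices of every
edge are comparable. -/
def IsTreeCover {V : Type u} [PartialOrder V] (G : SimpleGraph V) : Prop :=
  IsTree V ∧ ∀ x y : V, G.Adj x y → x ≤ y ∨ y ≤ x

/-- `p` is an `m`-pebbling function for `G` and the order on its vertex set. -/
def IsPebbling {V : Type u} [PartialOrder V] (G : SimpleGraph V) {m : ℕ} (p : V → Fin m) : Prop :=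
  ∀ x y : V, x ≤ y → G.Adj x y → ∀ z : V, z ≠ x → x ≤ z → z ≤ y → p z ≠ p x

/-- The number of common ancestors of `x` and `y` that lie strictly above `b` in the order. -/
noncomputable def gca {V : Type u} [PartialOrder V] (b x y : V) : ℕ :=
  {z : V | b < z ∧ z ≤ x ∧ z ≤ y}.ncard

/-! ### The set `𝒲ℒ_k^d` -/

/-- A `(k + d, k + d)`-bilabelled graph with pebbling data for its in- and out-labels. Label and
pebble indices start at `0`. -/
structure Augmented (k d : ℕ) : Type (u + 1) where
  toBilabelled : BilabelledGraph.{u} (k + d) (k + d)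
  pIn : Fin (k + d) → Fin (k + 1)
  pOut : Fin (k + d) → Fin (k + 1)

/-- Augmented bilabelled graphs together with the extra symbol `⊥`, which is `none`. -/
abbrev Elem (k d : ℕ) : Type (u + 1) := Option (Augmented.{u} k d)

/-- The eight axioms, one conjunct each, on an augmented bilabelled graph `F` with in-labels `u` and
out-labels `v`, an order on its vertex set, and a function `p` on its vertices. -/
def Axioms {k d : ℕ} (hk : 1 ≤ k) (F : Augmented.{u} k d) [PartialOrder F.toBilabelled.V]
    (p : F.toBilabelled.V → Fin (k + 1)) : Prop :=
  let u := F.toBilabelled.inLabel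
  let v := F.toBilabelled.outLabel
  -- the (1-based) labels `1`, `k` and `k + d`
  let first : Fin (k + d) := ⟨0, by omega⟩
  let base : Fin (k + d) := ⟨k - 1, by omega⟩
  let last : Fin (k + d) := ⟨k + d - 1, by omega⟩
  -- the first label is the root, the last labels are leaves
  (u first = v first ∧ (∀ x, u first ≤ x) ∧ IsLeaf (u last) ∧ IsLeaf (v last)) ∧
  -- the first `k` labels coincide, both label tuples are nondecreasing
  ((∀ i : Fin (k + d), (i : ℕ) < k → u i = v i) ∧ Monotone u ∧ Monotone v) ∧
  -- from the `k`-th label on, consecutive labels are in a cover relation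
  (∀ i j : Fin (k + d), k ≤ (i : ℕ) + 1 → (j : ℕ) = (i : ℕ) + 1 →
    (u i < u j ∧ ¬ ∃ x, u i < x ∧ x < u j) ∧ (v i < v j ∧ ¬ ∃ x, v i < x ∧ x < v j)) ∧
  -- unlabelled vertices are at or above the `k`-th label
  (∀ x, x ∉ Set.range u → x ∉ Set.range v → u base ≤ x) ∧
  -- all leaves have height `d` over the `k`-th label
  (∀ x, IsLeaf x → {y | u base < y ∧ y ≤ x}.ncard = d) ∧
  -- the last labels have the least number of common ancestors among all pairs of leaves
  (∀ x y, IsLeaf x → IsLeaf y → gca (u base) (u last) (v last) ≤ gca (u base) x y) ∧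
  -- `p` is injective on the first `k` labelled vertices
  (∀ i j : Fin (k + d), (i : ℕ) < k → (j : ℕ) < k → p (u i) = p (u j) → u i = u j) ∧
  -- the pebbling data are the values of `p` at the labels
  (∀ i, F.pIn i = p (u i) ∧ F.pOut i = p (v i))

/-- `𝒲ℒ_k^d`: the symbol `⊥`, and all augmented bilabelled graphs that admit a tree cover and a
`(k + 1)`-pebbling function satisfying the axioms. -/
def WL (k d : ℕ) (hk : 1 ≤ k) : Set (Elem.{u} k d) :=
  {X | X = none ∨ ∃ F : Augmented.{u} k d, X = some F ∧
    ∃ (_ : PartialOrder F.toBilabelled.V) (p : F.toBilabelled.V → Fin (k + 1)),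
      IsTreeCover F.toBilabelled.graph ∧ IsPebbling F.toBilabelled.graph p ∧ Axioms hk F p}

/-- Series composition on augmented bilabelled graphs and `⊥`. -/
def series {k d : ℕ} : Elem.{u} k d → Elem.{u} k d → Elem.{u} k d
  | some F, some F' =>
    if F.pOut = F'.pIn then
      some ⟨F.toBilabelled.series F'.toBilabelled, F.pIn, F'.pOut⟩
    else none
  | _, _ => none

/-- Equality of elements up to isomorphism of bilabelled graphs; the pebbling data have to agree. -/
def Same {k d : ℕ} : Elem.{u} k d → Elem.{v} k d → Prop
  | some F, some F' =>
    F.toBilabelled.Iso F'.toBilabelled ∧ F.pIn = F'.pIn ∧ F.pOut = F'.pOut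
  | none, none => True
  | _, _ => False

/-! ### The generators -/

/-- The vertex set `H ∪ {k + 1, …, k + d}`, as a subset of all (0-based) label indices. -/
def baseVertices {k : ℕ} (d : ℕ) (H : Set (Fin k)) : Set (Fin (k + d)) :=
  Fin.castAdd d '' H ∪ Set.range (Fin.natAdd k)

/-- The label tuple `h₁ ⋯ hₖ (k + 1) ⋯ (k + d)`. -/
def baseLabel {k d : ℕ} {H : Set (Fin k)} (h : Fin k → H) : Fin (k + d) → baseVertices d H :=
  Fin.addCases (fun i => ⟨Fin.castAdd d (h i), Or.inl ⟨h i, (h i).2, rfl⟩⟩)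
    (fun j => ⟨Fin.natAdd k j, Or.inr ⟨j, rfl⟩⟩)

/-- The bilabelled graph on `H ∪ {k + 1, …, k + d}` with edge set given by `G` and with both label
tuples equal to `h₁ ⋯ hₖ (k + 1) ⋯ (k + d)`. -/
def chainGraph {k d : ℕ} {H : Set (Fin k)} (h : Fin k → H)
    (G : SimpleGraph (baseVertices d H)) : BilabelledGraph.{0} (k + d) (k + d) where
  V := baseVertices d H
  finite_V := inferInstance
  graph := G
  inLabel := baseLabel h
  outLabel := baseLabel h

/-- The join graph `J^ℓ`: vertices `H ∪ {k + 1, …, k + d}` and copies `(ℓ + 1)', …, (k + d)'`, no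
edges, in-labels `h₁ ⋯ hₖ (k + 1) ⋯ (k + d)`, out-labels `h₁ ⋯ hₖ (k + 1) ⋯ ℓ (ℓ + 1)' ⋯ (k + d)'`.
The first `ℓ` labels are shared, i.e. those with 0-based index `< ℓ`. -/
def joinGraph {k d : ℕ} {H : Set (Fin k)} (h : Fin k → H) (l : ℕ) :
    BilabelledGraph.{0} (k + d) (k + d) where
  V := baseVertices d H ⊕ {i : Fin (k + d) // l ≤ (i : ℕ)}
  finite_V := inferInstance
  graph := ⊥
  inLabel := fun i => Sum.inl (baseLabel h i)
  outLabel := fun i =>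
    if hi : l ≤ (i : ℕ) then Sum.inr ⟨i, hi⟩ else Sum.inl (baseLabel h i)

/-- Pebbling data on the first `k` labels: labels carry the same pebble iff they sit on the same
vertex. -/
def Compatible {k d : ℕ} {H : Set (Fin k)} (h : Fin k → H) (p : Fin (k + d) → Fin (k + 1)) : Prop :=
  ∀ i j : Fin k, p (Fin.castAdd d i) = p (Fin.castAdd d j) ↔ h i = h j

/-- The generators `𝒜_k^d`: identity graphs, adjacency graphs and join graphs. The tuple `h` is
nondecreasing and its entries are exactly the elements of `H`. For the adjacency graph with edge
`xy`, where `x < y`, the pebble on `x` must not occur on any vertex `z` with `x < z ≤ y`; the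
pebble on a vertex is the value of `p` at any label sitting on that vertex. -/
inductive IsGenerator {k d : ℕ} : Elem.{0} k d → Prop
  | identity (H : Set (Fin k)) (h : Fin k → H) (hmono : Monotone h)
      (hsurj : Function.Surjective h) (p : Fin (k + d) → Fin (k + 1)) (hp : Compatible h p) :
      IsGenerator (some ⟨chainGraph h ⊥, p, p⟩)
  | adjacency (H : Set (Fin k)) (h : Fin k → H) (hmono : Monotone h)
      (hsurj : Function.Surjective h) (p : Fin (k + d) → Fin (k + 1)) (hp : Compatible h p)
      (x y : baseVertices d H) (hxy : x < y)
      (hpeb : ∀ a b : Fin (k + d), baseLabel h a = x → x < baseLabel h b → baseLabel h b ≤ y →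
        p a ≠ p b) :
      IsGenerator (some ⟨chainGraph h (SimpleGraph.edge x y), p, p⟩)
  | join (H : Set (Fin k)) (h : Fin k → H) (hmono : Monotone h)
      (hsurj : Function.Surjective h) (l : ℕ) (hkl : k ≤ l) (hld : l < k + d)
      (pIn pOut : Fin (k + d) → Fin (k + 1)) (hp : Compatible h pIn)
      (hagree : ∀ i : Fin (k + d), (i : ℕ) < l → pIn i = pOut i) :
      IsGenerator (some ⟨joinGraph h l, pIn, pOut⟩)

/-- The set `𝒜_k^d`. -/
def generators (k d : ℕ) : Set (Elem.{0} k d) := {X | IsGenerator X}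

end PebbleWL

namespace PebbleWL

/-! The tree cover is swept path by path. In a tree cover satisfying the axioms, the base `b` is the
`k`-th label. The vertices not above `b` are among the first `k` labels, and every leaf lies exactly
`d` cover steps above `b`. So each leaf determines a label tuple, a leaf path, consisting of the
first `k` labels followed by the ascent to that leaf. The tuples `u` and `v` are themselves leaf
paths. Every vertex lies on some leaf path, and an edge, having comparable ends, lies within one.

A composite of generators is built inside the fixed vertex set `V`, with all pebbling data read off
the one function `p`. Its out-labels move from one leaf path to another: a join graph replaces the
part of the tuple above the branching point, and adjacency graphs then add the edges on the new
path. Series composition becomes union in `V` as long as the new piece meets the old one only in the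
current out-labels (`Realizes.series`).

The order of the sweep comes from induction on the set of paths (`IsBranching.obtainable`), with the
endpoint `v` removed last. The invariant is that `u` and `v` agree only where all paths agree, which
is what the axiom on `gca` provides (`eq_of_gca_le`). `IsBranching.exists_predecessor` finds the
path from which `v` is reached and preserves the invariant. -/

/-! ### Realizations of bilabelled graphs inside a fixed vertex set -/

/-- `X` is isomorphic to the bilabelled graph with vertex set `S`, edges those of `G`, in-labels `a`
and out-labels `b`. -/
def Realizes {V : Type u} {m n : ℕ} (X : BilabelledGraph.{v} m n) (S : Set V) (G : SimpleGraph V)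
    (a : Fin m → V) (b : Fin n → V) : Prop :=
  ∃ f : X.V → V, Function.Injective f ∧ Set.range f = S ∧
    (∀ s t, G.Adj s t ↔ ∃ x y, X.graph.Adj x y ∧ f x = s ∧ f y = t) ∧
    (∀ i, f (X.inLabel i) = a i) ∧ (∀ i, f (X.outLabel i) = b i)

/-- Since `S` and `T` overlap only in entries of `b`, two vertices with the same image in `V` carry
a common label and are therefore glued. The map from the quotient to `V` is thus injective. -/
theorem Realizes.series {V : Type u} {l m n : ℕ} {X : BilabelledGraph.{v} l m}
    {Y : BilabelledGraph.{v} m n} {S T : Set V} {G K : SimpleGraph V}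
    {a : Fin l → V} {b : Fin m → V} {c : Fin n → V}
    (hX : Realizes X S G a b) (hY : Realizes Y T K b c) (hST : S ∩ T ⊆ Set.range b) :
    Realizes (X.series Y) (S ∪ T) (G ⊔ K) a c := by
  obtain ⟨f, hf, rfl, hfG, hfa, hfb⟩ := hX
  obtain ⟨g, hg, rfl, hgK, hgb, hgc⟩ := hY
  have hglue : ∀ x y, X.Glue Y x y → Sum.elim f g x = Sum.elim f g y := by
    rintro _ _ ⟨i, rfl, rfl⟩
    simp [hfb, hgb]
  have key : ∀ x y, f x = g y →
      (Quot.mk _ (Sum.inl x) : Quot (X.Glue Y)) = Quot.mk _ (Sum.inr y) := by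
    intro x y hxy
    obtain ⟨i, hi⟩ := hST ⟨⟨x, rfl⟩, ⟨y, hxy.symm⟩⟩
    refine Quot.sound ⟨i, ?_, ?_⟩
    · rw [hf ((hfb i).trans hi)]
    · rw [hg ((hgb i).trans (hi.trans hxy))]
  have hinj : Function.Injective (Quot.lift (Sum.elim f g) hglue) := by
    rintro ⟨x | x⟩ ⟨y | y⟩ h
    · exact congrArg (fun z => Quot.mk _ (Sum.inl z)) (hf h)
    · exact key x y h
    · exact (key y x h.symm).symm
    · exact congrArg (fun z => Quot.mk _ (Sum.inr z)) (hg h)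
  refine ⟨Quot.lift (Sum.elim f g) hglue, hinj, ?_, ?_, hfa, hgc⟩
  · ext s
    constructor
    · rintro ⟨⟨x | x⟩, rfl⟩
      · exact Or.inl ⟨x, rfl⟩
      · exact Or.inr ⟨x, rfl⟩
    · rintro (⟨x, rfl⟩ | ⟨x, rfl⟩)
      · exact ⟨Quot.mk _ (Sum.inl x), rfl⟩
      · exact ⟨Quot.mk _ (Sum.inr x), rfl⟩
  · intro s t
    constructor
    · intro hst
      have hne : s ≠ t := hst.ne
      rcases hst with h | h
      · obtain ⟨x, y, hxy, rfl, rfl⟩ := (hfG s t).1 h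
        exact ⟨Quot.mk _ (Sum.inl x), Quot.mk _ (Sum.inl y),
          ⟨fun e => hne (congrArg (Quot.lift (Sum.elim f g) hglue) e), _, _, rfl, rfl, hxy⟩,
          rfl, rfl⟩
      · obtain ⟨x, y, hxy, rfl, rfl⟩ := (hgK s t).1 h
        exact ⟨Quot.mk _ (Sum.inr x), Quot.mk _ (Sum.inr y),
          ⟨fun e => hne (congrArg (Quot.lift (Sum.elim f g) hglue) e), _, _, rfl, rfl, hxy⟩,
          rfl, rfl⟩
    · rintro ⟨_, _, ⟨-, x, y, rfl, rfl, hxy⟩, rfl, rfl⟩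
      rcases x with x | x <;> rcases y with y | y
      · exact Or.inl ((hfG _ _).2 ⟨x, y, hxy, rfl, rfl⟩)
      · simp [SimpleGraph.sum] at hxy
      · simp [SimpleGraph.sum] at hxy
      · exact Or.inr ((hgK _ _).2 ⟨x, y, hxy, rfl, rfl⟩)

theorem Realizes.iso {m n : ℕ} {F : BilabelledGraph.{u} m n} {X : BilabelledGraph.{v} m n}
    (h : Realizes X Set.univ F.graph F.inLabel F.outLabel) : F.Iso X := by
  obtain ⟨f, hf, hr, hG, ha, hb⟩ := h
  let e : X.V ≃ F.V := Equiv.ofBijective f ⟨hf, Set.range_eq_univ.1 hr⟩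
  have he : ∀ x, e x = f x := fun _ => rfl
  refine ⟨⟨e.symm, ?_⟩, ?_, ?_⟩
  · intro s t
    rw [hG]
    constructor
    · intro h
      exact ⟨_, _, h, by rw [← he, e.apply_symm_apply], by rw [← he, e.apply_symm_apply]⟩
    · rintro ⟨x, y, hxy, rfl, rfl⟩
      rw [← he, ← he, e.symm_apply_apply, e.symm_apply_apply]
      exact hxy
  · intro i
    change e.symm _ = _
    rw [Equiv.symm_apply_eq, he, ha]
  · intro i
    change e.symm _ = _
    rw [Equiv.symm_apply_eq, he, hb]

/-! ### Products of generators -/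

/-- `X` is a series composition of one or more generators. -/
def IsComposite {k d : ℕ} (X : Elem.{0} k d) : Prop :=
  ∃ (A : Elem.{0} k d) (L : List (Elem.{0} k d)),
    A ∈ generators k d ∧ (∀ B ∈ L, B ∈ generators k d) ∧ L.foldl series A = X

theorem IsGenerator.isComposite {k d : ℕ} {X : Elem.{0} k d} (h : IsGenerator X) :
    IsComposite X :=
  ⟨X, [], h, by simp, rfl⟩

theorem IsComposite.series {k d : ℕ} {X Y : Elem.{0} k d} (hX : IsComposite X)
    (hY : IsGenerator Y) : IsComposite (series X Y) := by
  obtain ⟨A, L, hA, hL, rfl⟩ := hX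
  refine ⟨A, L ++ [Y], hA, ?_, by simp⟩
  intro B hB
  rcases List.mem_append.1 hB with h | h
  · exact hL B h
  · rw [List.mem_singleton.1 h]
    exact hY

/-- The graph on `S` with the edges of `G`, with label tuples `a` and `b` and with pebbling data
given by `p`, is a series composition of generators. -/
def Obtainable {V : Type u} {k d : ℕ} (p : V → Fin (k + 1)) (S : Set V) (G : SimpleGraph V)
    (a b : Fin (k + d) → V) : Prop :=
  ∃ X : BilabelledGraph.{0} (k + d) (k + d),
    IsComposite (some ⟨X, p ∘ a, p ∘ b⟩) ∧ Realizes X S G a b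

/-- Both factors take their middle pebbling data from `p ∘ b`, so the composition never yields `⊥`.
-/
theorem Obtainable.series {V : Type u} {k d : ℕ} {p : V → Fin (k + 1)} {S T : Set V}
    {G K : SimpleGraph V} {a b c : Fin (k + d) → V} {Y : BilabelledGraph.{0} (k + d) (k + d)}
    (h : Obtainable p S G a b) (hY : IsGenerator (some ⟨Y, p ∘ b, p ∘ c⟩))
    (hYr : Realizes Y T K b c) (hST : S ∩ T ⊆ Set.range b) :
    Obtainable p (S ∪ T) (G ⊔ K) a c := by
  obtain ⟨X, hX, hXr⟩ := h
  refine ⟨X.series Y, ?_, hXr.series hYr hST⟩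
  simpa [PebbleWL.series] using hX.series hY

/-! ### Label tuples and the generators they realize -/

/-- A tuple that can occur as in- or out-labels: nondecreasing, repeating entries only among the
first `k`, and with `p` separating the first `k` entries. -/
structure IsLabelling {V : Type u} [PartialOrder V] {k d : ℕ} (p : V → Fin (k + 1))
    (a : Fin (k + d) → V) : Prop where
  mono : Monotone a
  eq_or : ∀ i j, a i = a j → i = j ∨ ((i : ℕ) < k ∧ (j : ℕ) < k)
  pebble : ∀ i j : Fin (k + d), (i : ℕ) < k → (j : ℕ) < k → p (a i) = p (a j) → a i = a j

open Classical in
/-- The first position at which the `i`-th label occurs. -/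
noncomputable def firstIndex {V : Type u} {k d : ℕ} (a : Fin (k + d) → V) (i : Fin k) : Fin k :=
  (Finset.univ.filter fun j => a (Fin.castAdd d j) = a (Fin.castAdd d i)).min' ⟨i, by simp⟩

theorem apply_firstIndex {V : Type u} {k d : ℕ} (a : Fin (k + d) → V) (i : Fin k) :
    a (Fin.castAdd d (firstIndex a i)) = a (Fin.castAdd d i) := by
  classical
  have := Finset.min'_mem
    (Finset.univ.filter fun j => a (Fin.castAdd d j) = a (Fin.castAdd d i)) ⟨i, by simp⟩
  simpa [firstIndex] using this

theorem firstIndex_le {V : Type u} {k d : ℕ} (a : Fin (k + d) → V) {i j : Fin k}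
    (h : a (Fin.castAdd d j) = a (Fin.castAdd d i)) : firstIndex a i ≤ j := by
  classical
  exact Finset.min'_le _ _ (by simpa using h)

theorem firstIndex_eq_iff {V : Type u} {k d : ℕ} (a : Fin (k + d) → V) {i j : Fin k} :
    firstIndex a i = firstIndex a j ↔ a (Fin.castAdd d i) = a (Fin.castAdd d j) := by
  constructor
  · intro h
    rw [← apply_firstIndex a i, h, apply_firstIndex a]
  · intro h
    apply le_antisymm
    · exact firstIndex_le a ((apply_firstIndex a j).trans h.symm)
    · exact firstIndex_le a ((apply_firstIndex a i).trans h)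

/-- `firstIndex` with its range as codomain. -/
noncomputable def firstLabel {V : Type u} {k d : ℕ} (a : Fin (k + d) → V) :
    Fin k → Set.range (firstIndex a) :=
  Set.rangeFactorization (firstIndex a)

/-- If the first occurrence of the `j`-th entry comes before `i ≤ j`, then `a i` is squeezed between
two equal entries. -/
theorem monotone_firstLabel {V : Type u} [PartialOrder V] {k d : ℕ} {a : Fin (k + d) → V}
    (ha : Monotone a) : Monotone (firstLabel a) := by
  intro i j hij
  change firstIndex a i ≤ firstIndex a j
  rcases le_total i (firstIndex a j) with h | h
  · exact (firstIndex_le a rfl).trans h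
  · refine firstIndex_le a (le_antisymm (ha h) ?_)
    rw [apply_firstIndex a]
    exact ha hij

theorem surjective_firstLabel {V : Type u} {k d : ℕ} (a : Fin (k + d) → V) :
    Function.Surjective (firstLabel a) :=
  Set.rangeFactorization_surjective

/-- Generators live on label positions; `w ↦ a w` places them in `V`. Passing to a representative
position does not move the vertex. -/
theorem apply_baseLabel {V : Type u} {k d : ℕ} (a : Fin (k + d) → V) (i : Fin (k + d)) :
    a (baseLabel (firstLabel a) i).1 = a i := by
  refine Fin.addCases (fun i => ?_) (fun j => ?_) i
  · simp [baseLabel, firstLabel, apply_firstIndex]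
  · simp [baseLabel]

theorem range_apply_baseVertices {V : Type u} {k d : ℕ} (a : Fin (k + d) → V) :
    (Set.range fun w : baseVertices d (Set.range (firstIndex a)) => a w.1) = Set.range a := by
  ext s
  constructor
  · rintro ⟨w, rfl⟩
    exact ⟨w.1, rfl⟩
  · rintro ⟨i, rfl⟩
    exact ⟨_, apply_baseLabel a i⟩

namespace IsLabelling

variable {V : Type u} [PartialOrder V] {k d : ℕ} {p : V → Fin (k + 1)} {a b : Fin (k + d) → V}

/-- Positions from `k` on never repeat a vertex, and of the first `k` only first occurrences are
kept. -/
theorem injective (ha : IsLabelling p a) :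
    Function.Injective fun w : baseVertices d (Set.range (firstIndex a)) => a w.1 := by
  rintro ⟨x, hx⟩ ⟨y, hy⟩ h
  have h' : a x = a y := h
  rcases ha.eq_or _ _ h' with h1 | ⟨h1, h2⟩
  · exact Subtype.ext h1
  · rcases hx with ⟨_, ⟨i, rfl⟩, rfl⟩ | ⟨i, rfl⟩
    · rcases hy with ⟨_, ⟨j, rfl⟩, rfl⟩ | ⟨j, rfl⟩
      · rw [apply_firstIndex a, apply_firstIndex a] at h'
        exact Subtype.ext (congrArg (Fin.castAdd d) ((firstIndex_eq_iff a).2 h'))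
      · simp at h2
    · simp at h1

theorem compatible (ha : IsLabelling p a) : Compatible (firstLabel a) (p ∘ a) := by
  intro i j
  have : firstLabel a i = firstLabel a j ↔ firstIndex a i = firstIndex a j := Subtype.ext_iff
  rw [this, firstIndex_eq_iff]
  exact ⟨ha.pebble _ _ (by simp) (by simp), fun h => congrArg p h⟩

theorem obtainable (ha : IsLabelling p a) : Obtainable p (Set.range a) ⊥ a a := by
  refine ⟨_, (IsGenerator.identity _ (firstLabel a) (monotone_firstLabel ha.mono)
    (surjective_firstLabel a) _ ha.compatible).isComposite, ?_⟩
  exact ⟨fun w => a w.1, ha.injective, range_apply_baseVertices a, by simp [chainGraph],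
    apply_baseLabel a, apply_baseLabel a⟩

theorem realizes_edge (ha : IsLabelling p a) {x y : baseVertices d (Set.range (firstIndex a))} :
    Realizes (chainGraph (firstLabel a) (SimpleGraph.edge x y)) (Set.range a)
      (SimpleGraph.edge (a x.1) (a y.1)) a a := by
  refine ⟨fun w => a w.1, ha.injective, range_apply_baseVertices a, ?_, apply_baseLabel a, apply_baseLabel a⟩
  intro s t
  constructor
  · intro h
    obtain ⟨h, hne⟩ := (SimpleGraph.edge_adj ..).1 h
    rcases h with ⟨rfl, rfl⟩ | ⟨rfl, rfl⟩
    · exact ⟨x, y, (SimpleGraph.edge_adj ..).2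
        ⟨Or.inl ⟨rfl, rfl⟩, fun e => hne (by rw [e])⟩, rfl, rfl⟩
    · exact ⟨y, x, (SimpleGraph.edge_adj ..).2
        ⟨Or.inr ⟨rfl, rfl⟩, fun e => hne (by rw [e])⟩, rfl, rfl⟩
  · rintro ⟨x', y', h, rfl, rfl⟩
    obtain ⟨h, hne⟩ := (SimpleGraph.edge_adj ..).1 h
    refine (SimpleGraph.edge_adj ..).2 ⟨?_, fun e => hne (ha.injective e)⟩
    rcases h with ⟨h1, h2⟩ | ⟨h1, h2⟩
    · exact Or.inl ⟨congrArg (fun w => a w.1) h1, congrArg (fun w => a w.1) h2⟩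
    · exact Or.inr ⟨congrArg (fun w => a w.1) h1, congrArg (fun w => a w.1) h2⟩

/-- An edge between two entries of the out-label tuple can be added by an adjacency graph. -/
theorem obtainable_sup_edge (hb : IsLabelling p b) {S : Set V} {G K : SimpleGraph V}
    (h : Obtainable p S G a b) (hS : Set.range b ⊆ S) (hK : IsPebbling K p) {s t : V}
    (hs : s ∈ Set.range b) (ht : t ∈ Set.range b) (hst : K.Adj s t) :
    Obtainable p S (G ⊔ SimpleGraph.edge s t) a b := by
  have main : ∀ i j, i ≤ j → K.Adj (b i) (b j) →
      Obtainable p S (G ⊔ SimpleGraph.edge (b i) (b j)) a b := by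
    intro i j hij hadj
    have hlt : b i < b j := lt_of_le_of_ne (hb.mono hij) hadj.ne
    have hxy : baseLabel (firstLabel b) i < baseLabel (firstLabel b) j := by
      refine lt_of_not_ge fun hge => hlt.not_ge ?_
      have := hb.mono (show (baseLabel (firstLabel b) j).1 ≤ (baseLabel (firstLabel b) i).1 from hge)
      rwa [apply_baseLabel b, apply_baseLabel b] at this
    have hgen := IsGenerator.adjacency (d := d) _ (firstLabel b) (monotone_firstLabel hb.mono)
      (surjective_firstLabel b) (p ∘ b) hb.compatible _ _ hxy (by
        intro m n hm hn1 hn2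
        have e1 : b m = b i := by rw [← apply_baseLabel b m, hm, apply_baseLabel b]
        have l1 := hb.mono (show (baseLabel (firstLabel b) i).1 ≤
          (baseLabel (firstLabel b) n).1 from hn1.le)
        have l2 := hb.mono (show (baseLabel (firstLabel b) n).1 ≤
          (baseLabel (firstLabel b) j).1 from hn2)
        rw [apply_baseLabel b, apply_baseLabel b] at l1 l2
        -- Monotonicity of `b` gives only `b i ≤ b n`; the pebbling condition needs `b n ≠ b i`,
        -- which comes from injectivity on representatives.
        have hne : b n ≠ b i := by
          intro e
          rw [← apply_baseLabel b n, ← apply_baseLabel b i] at e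
          exact hn1.ne' (hb.injective e)
        simp only [Function.comp_apply, e1]
        exact (hK _ _ hlt.le hadj _ hne l1 l2).symm)
    have := h.series hgen hb.realizes_edge Set.inter_subset_right
    rwa [apply_baseLabel b, apply_baseLabel b, Set.union_eq_self_of_subset_right hS] at this
  obtain ⟨i, rfl⟩ := hs
  obtain ⟨j, rfl⟩ := ht
  rcases le_total i j with hij | hij
  · exact main i j hij hst
  · rw [SimpleGraph.edge_comm]
    exact main j i hij hst.symm

/-- A finite graph is the supremum of its edges, so adjacency graphs can be appended one at a time.
-/
theorem obtainable_sup [Finite V] (hb : IsLabelling p b) {S : Set V} {G K : SimpleGraph V}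
    (h : Obtainable p S G a b) (hS : Set.range b ⊆ S) (hK : IsPebbling K p)
    (hKb : ∀ s t, K.Adj s t → s ∈ Set.range b ∧ t ∈ Set.range b) :
    Obtainable p S (G ⊔ K) a b := by
  classical
  have := Fintype.ofFinite V
  have main : ∀ Q : Finset (V × V), (∀ q ∈ Q, K.Adj q.1 q.2) →
      Obtainable p S (G ⊔ Q.sup fun q => SimpleGraph.edge q.1 q.2) a b := by
    intro Q
    induction Q using Finset.induction_on with
    | empty => simpa using h
    | insert q Q _ ih =>
      intro hQ
      have hq := hQ q (Finset.mem_insert_self _ _)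
      rw [Finset.sup_insert, sup_comm (SimpleGraph.edge _ _), ← sup_assoc]
      exact hb.obtainable_sup_edge (ih fun r hr => hQ r (Finset.mem_insert_of_mem hr)) hS hK
        (hKb _ _ hq).1 (hKb _ _ hq).2 hq
  have hsup : (Finset.univ.filter fun q : V × V => K.Adj q.1 q.2).sup
      (fun q => SimpleGraph.edge q.1 q.2) = K := by
    apply le_antisymm
    · refine Finset.sup_le fun q hq => ?_
      have hq : K.Adj q.1 q.2 := by simpa using hq
      intro s t hst
      rcases (SimpleGraph.edge_adj ..).1 hst with ⟨⟨rfl, rfl⟩ | ⟨rfl, rfl⟩, -⟩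
      · exact hq
      · exact hq.symm
    · intro s t hst
      exact Finset.le_sup (f := fun q : V × V => SimpleGraph.edge q.1 q.2)
        (b := (s, t)) (by simpa using hst)
        ((SimpleGraph.edge_adj ..).2 ⟨Or.inl ⟨rfl, rfl⟩, hst.ne⟩)
  have := main (Finset.univ.filter fun q : V × V => K.Adj q.1 q.2) (by simp)
  rwa [hsup] at this

/-- Passing to a tuple that leaves the old one from position `l` on. -/
theorem obtainable_join {c : Fin (k + d) → V} (hb : IsLabelling p b) (hc : IsLabelling p c)
    {S : Set V} {G : SimpleGraph V} (h : Obtainable p S G a b) {l : ℕ} (hkl : k ≤ l)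
    (hld : l < k + d) (heq : ∀ i : Fin (k + d), (i : ℕ) < l → b i = c i)
    (hnotMem : ∀ i : Fin (k + d), l ≤ (i : ℕ) → c i ∉ Set.range b)
    (hS : S ∩ Set.range c ⊆ Set.range b) (hbS : Set.range b ⊆ S) :
    Obtainable p (S ∪ Set.range c) G a c := by
  have hgen := IsGenerator.join (d := d) _ (firstLabel b) (monotone_firstLabel hb.mono)
    (surjective_firstLabel b) l hkl hld (p ∘ b) (p ∘ c) hb.compatible
    (fun i hi => by simp [heq i hi])
  have hr : Realizes (joinGraph (firstLabel b) l) (Set.range b ∪ Set.range c) ⊥ b c := by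
    refine ⟨Sum.elim (fun w => b w.1) (fun i => c i.1), ?_, ?_, by simp [joinGraph],
      apply_baseLabel b, ?_⟩
    · rintro (x | x) (y | y) hxy
      · exact congrArg Sum.inl (hb.injective hxy)
      · exact (hnotMem y.1 y.2 ⟨x.1, hxy⟩).elim
      · exact (hnotMem x.1 x.2 ⟨y.1, hxy.symm⟩).elim
      -- Copied positions are at least `l ≥ k`, where a labelling does not repeat.
      · rcases hc.eq_or _ _ hxy with e | ⟨e, -⟩
        · exact congrArg Sum.inr (Subtype.ext e)
        · exact absurd (e.trans_le (hkl.trans x.2)) (lt_irrefl _)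
    · ext s
      constructor
      · rintro ⟨x | x, rfl⟩
        · exact Or.inl ⟨x.1, rfl⟩
        · exact Or.inr ⟨x.1, rfl⟩
      · rintro (⟨i, rfl⟩ | ⟨i, rfl⟩)
        · exact ⟨Sum.inl _, apply_baseLabel b i⟩
        · rcases lt_or_ge (i : ℕ) l with hi | hi
          · exact ⟨Sum.inl _, (apply_baseLabel b i).trans (heq i hi)⟩
          · exact ⟨Sum.inr ⟨i, hi⟩, rfl⟩
    · intro i
      by_cases hi : l ≤ (i : ℕ)
      · simp [joinGraph, hi]
      · simp only [joinGraph, hi, dite_false, Sum.elim_inl, apply_baseLabel]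
        exact heq i (not_le.1 hi)
  have := h.series hgen hr (by
    rintro s ⟨hs, h1 | h1⟩
    · exact h1
    · exact hS ⟨hs, h1⟩)
  rwa [sup_bot_eq, ← Set.union_assoc, Set.union_eq_self_of_subset_right hbS] at this

end IsLabelling

/-! ### Families of labellings branching like the leaves of a tree -/

/-- A family of label tuples that agree on the first `k` labels, and any two of which agree exactly
on an initial segment and share no further vertices. -/
structure IsBranching {V : Type u} [PartialOrder V] {k d : ℕ} (p : V → Fin (k + 1))
    (P : Set (Fin (k + d) → V)) : Prop where
  labelling : ∀ a ∈ P, IsLabelling p a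
  base : ∀ a ∈ P, ∀ b ∈ P, ∀ i : Fin (k + d), (i : ℕ) < k → a i = b i
  eq_or : ∀ a ∈ P, ∀ b ∈ P, ∀ i j, a i = b j → i = j ∨ ((i : ℕ) < k ∧ (j : ℕ) < k)
  lower : ∀ a ∈ P, ∀ b ∈ P, ∀ i j, i ≤ j → a j = b j → a i = b i

theorem IsBranching.mono {V : Type u} [PartialOrder V] {k d : ℕ} {p : V → Fin (k + 1)}
    {P Q : Set (Fin (k + d) → V)} (h : IsBranching p P) (hQ : Q ⊆ P) : IsBranching p Q :=
  ⟨fun a ha => h.labelling a (hQ ha), fun a ha b hb => h.base a (hQ ha) b (hQ hb),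
    fun a ha b hb => h.eq_or a (hQ ha) b (hQ hb), fun a ha b hb => h.lower a (hQ ha) b (hQ hb)⟩

open Classical in
/-- The number of positions at which two tuples agree. -/
noncomputable def agreement {V : Type u} {n : ℕ} (a b : Fin n → V) : ℕ :=
  (Finset.univ.filter fun i => a i = b i).card

/-- The positions of agreement form an initial segment, which is determined by its size. -/
theorem eq_iff_lt_agreement {V : Type u} {n : ℕ} {a b : Fin n → V}
    (h : ∀ i j, i ≤ j → a j = b j → a i = b i) (i : Fin n) :
    a i = b i ↔ (i : ℕ) < agreement a b := by
  classical
  constructor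
  · intro hi
    have : Finset.Iic i ⊆ Finset.univ.filter fun j => a j = b j := by
      intro j hj
      simpa using h j i (by simpa using hj) hi
    have := Finset.card_le_card this
    rw [Fin.card_Iic] at this
    unfold agreement
    refine Nat.lt_of_succ_le ?_
    convert this
  · intro hi
    by_contra hne
    have : (Finset.univ.filter fun j => a j = b j) ⊆ Finset.Iio i := by
      intro j hj
      have hj : a j = b j := by simpa using hj
      simp only [Finset.mem_Iio]
      by_contra hji
      exact hne (h i j (not_lt.1 hji) hj)
    have := Finset.card_le_card this
    rw [Fin.card_Iio] at this
    unfold agreement at hi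
    apply hi.not_ge
    convert this

/-- The vertices occurring in a family of tuples. -/
def vertices {V : Type u} {n : ℕ} (P : Set (Fin n → V)) : Set V :=
  {x | ∃ a ∈ P, x ∈ Set.range a}

/-- The edges of `G` both endpoints of which occur in a common tuple of the family. -/
def graphOn {V : Type u} {n : ℕ} (G : SimpleGraph V) (P : Set (Fin n → V)) : SimpleGraph V where
  Adj x y := G.Adj x y ∧ ∃ a ∈ P, x ∈ Set.range a ∧ y ∈ Set.range a
  symm := ⟨fun _ _ ⟨h, a, ha, hx, hy⟩ => ⟨h.symm, a, ha, hy, hx⟩⟩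
  loopless := ⟨fun _ h => h.1.ne rfl⟩

theorem graphOn_insert {V : Type u} {n : ℕ} (G : SimpleGraph V) (a : Fin n → V)
    (P : Set (Fin n → V)) : graphOn G (insert a P) = graphOn G P ⊔ graphOn G {a} := by
  ext x y
  simp only [graphOn, SimpleGraph.sup_adj, Set.mem_insert_iff, exists_eq_or_imp,
    Set.mem_singleton_iff, exists_eq_left]
  rw [← and_or_left, or_comm]

theorem vertices_insert {V : Type u} {n : ℕ} (a : Fin n → V) (P : Set (Fin n → V)) :
    vertices (insert a P) = vertices P ∪ Set.range a := by
  ext x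
  simp only [vertices, Set.mem_insert_iff, exists_eq_or_imp, Set.mem_ofPred_eq, Set.mem_union]
  exact or_comm

theorem IsPebbling.mono {V : Type u} [PartialOrder V] {G K : SimpleGraph V} {m : ℕ}
    {p : V → Fin m} (h : IsPebbling G p) (hK : K ≤ G) : IsPebbling K p :=
  fun x y hxy hadj => h x y hxy (hK hadj)

/-- Adding the edges on the out-label tuple of a family. -/
theorem Obtainable.sup_graphOn {V : Type u} [PartialOrder V] [Finite V] {k d : ℕ}
    {p : V → Fin (k + 1)} {S : Set V} {G K : SimpleGraph V} {a b : Fin (k + d) → V}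
    (h : Obtainable p S K a b) (hb : IsLabelling p b) (hS : Set.range b ⊆ S)
    (hG : IsPebbling G p) : Obtainable p S (K ⊔ graphOn G {b}) a b := by
  refine hb.obtainable_sup h hS (hG.mono fun _ _ h => h.1) ?_
  rintro s t ⟨-, _, rfl, hs, ht⟩
  exact ⟨hs, ht⟩

/-- A tuple to which the out-labels can jump back when `v` is removed from the family. -/
theorem IsBranching.exists_predecessor {V : Type u} [PartialOrder V] {k d : ℕ}
    {p : V → Fin (k + 1)} {P : Set (Fin (k + d) → V)} (hP : IsBranching p P)
    {Q : Finset (Fin (k + d) → V)} (hQ : ↑Q ⊆ P) {u v : Fin (k + d) → V} (hu : u ∈ Q) (hv : v ∈ P)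
    (hmin : ∀ i, u i = v i → ∀ a ∈ P, ∀ b ∈ P, a i = b i) :
    ∃ w ∈ Q, (∀ a ∈ Q, ∀ i, a i = v i → w i = v i) ∧
      ∀ i, u i = w i → ∀ a ∈ Q, ∀ b ∈ Q, a i = b i := by
  classical
  have agr : ∀ a ∈ P, ∀ b ∈ P, ∀ i, a i = b i ↔ (i : ℕ) < agreement a b :=
    fun a ha b hb => eq_iff_lt_agreement (hP.lower a ha b hb)
  -- The choice is lexicographic: greatest agreement with `v`, then, among ties, least agreement
  -- with `u`.
  obtain ⟨w₀, hw₀, hmax⟩ := Q.exists_max_image (fun a => agreement a v) ⟨u, hu⟩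
  obtain ⟨w, hw, hw'⟩ := (Q.filter fun a => agreement a v = agreement w₀ v).exists_min_image
    (fun a => agreement u a) ⟨w₀, by simp [hw₀]⟩
  obtain ⟨hwQ, hwe⟩ := Finset.mem_filter.1 hw
  have huP := hQ hu
  have hwP := hQ hwQ
  refine ⟨w, hwQ, ?_, ?_⟩
  · intro a ha i hi
    rw [agr _ hwP _ hv, hwe]
    exact ((agr _ (hQ ha) _ hv i).1 hi).trans_le (hmax a ha)
  · intro i hi
    suffices h : ∀ a ∈ Q, u i = a i from fun a ha b hb => (h a ha).symm.trans (h b hb)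
    intro a ha
    by_cases huv : u i = v i
    · exact hmin i huv u huP a (hQ ha)
    · have hwv : ¬ w i = v i := fun e => huv (hi.trans e)
      rw [agr _ hwP _ hv, hwe] at hwv
      -- Every `a ∈ Q` ties with `w₀`. Otherwise, at the first position where `a` leaves `v`, the
      -- tuples `u`, `w` and `v` still agree, so `hmin` makes `a` agree with `v` there too.
      have hae : agreement a v = agreement w₀ v := by
        refine le_antisymm (hmax a ha) (not_lt.1 fun hlt => ?_)
        have hlt' : agreement a v < k + d := hlt.trans_le ((not_lt.1 hwv).trans i.2.le)
        have hj : w ⟨agreement a v, hlt'⟩ = v ⟨agreement a v, hlt'⟩ := by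
          rw [agr _ hwP _ hv, hwe]
          exact hlt
        have hju : u ⟨agreement a v, hlt'⟩ = w ⟨agreement a v, hlt'⟩ :=
          hP.lower u huP w hwP _ i (hlt.le.trans (not_lt.1 hwv)) hi
        have := hmin _ (hju.trans hj) a (hQ ha) v hv
        rw [agr _ (hQ ha) _ hv] at this
        exact lt_irrefl _ this
      rw [agr _ huP _ (hQ ha)]
      exact ((agr _ huP _ hwP i).1 hi).trans_le (hw' a (by simp [ha, hae]))

/-- Induction on `P` with `u` fixed: a composite covering `P` without `v` and ending at a suitable
`w` is extended by one join from `w` to `v` and by the edges on `v`. -/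
theorem IsBranching.obtainable {V : Type u} [PartialOrder V] [Finite V] {k d : ℕ}
    {p : V → Fin (k + 1)} {G : SimpleGraph V} (hG : IsPebbling G p)
    (P : Finset (Fin (k + d) → V)) (hP : IsBranching p (P : Set (Fin (k + d) → V)))
    {u v : Fin (k + d) → V} (hu : u ∈ P) (hv : v ∈ P)
    (hmin : ∀ i, u i = v i → ∀ a ∈ P, ∀ b ∈ P, a i = b i) :
    Obtainable p (vertices (P : Set (Fin (k + d) → V))) (graphOn G (P : Set (Fin (k + d) → V))) u v := by
  classical
  induction P using Finset.strongInduction generalizing v with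
  | H P ih =>
    have hvl := hP.labelling v hv
    by_cases huv : u = v
    · subst huv
      have hPu : P = {u} := by
        refine Finset.eq_singleton_iff_unique_mem.2 ⟨hu, fun a ha => ?_⟩
        exact funext fun i => hmin i rfl a ha u hu
      subst hPu
      have := hvl.obtainable.sup_graphOn hvl subset_rfl hG
      simpa [vertices, Set.range] using this
    · have huQ : u ∈ P.erase v := Finset.mem_erase.2 ⟨huv, hu⟩
      have hQP : ((P.erase v : Finset _) : Set (Fin (k + d) → V)) ⊆ P := by
        simp
      obtain ⟨w, hwQ, hmax, hmin'⟩ := hP.exists_predecessor hQP huQ hv hmin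
      have hwP : w ∈ P := Finset.mem_of_mem_erase hwQ
      have hwl := hP.labelling w hwP
      have agr := eq_iff_lt_agreement (hP.lower w hwP v hv)
      have hrec := ih _ (Finset.erase_ssubset hv) (hP.mono hQP) huQ hwQ hmin'
      obtain ⟨i, hi⟩ := Function.ne_iff.1 (Finset.ne_of_mem_erase hwQ)
      rw [Ne, agr, not_lt] at hi
      have hkl : k ≤ agreement w v := by
        by_contra hlt
        have := (agr ⟨agreement w v, by omega⟩).1 (hP.base w hwP v hv _ (not_le.1 hlt))
        exact lt_irrefl _ this
      have hjoin := hwl.obtainable_join hvl hrec hkl (hi.trans_lt i.2)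
        (fun j hj => (agr j).2 hj) ?_ ?_ ?_
      · have := hjoin.sup_graphOn hvl Set.subset_union_right hG
        rw [← vertices_insert, ← graphOn_insert, ← Finset.coe_insert, Finset.insert_erase hv]
          at this
        exact this
      · rintro j hj ⟨m, hm⟩
        rcases hP.eq_or w hwP v hv m j hm with rfl | ⟨-, h2⟩
        · exact hj.not_gt ((agr m).1 hm)
        · omega
      -- Maximality of the agreement of `w` with `v` is used here: whatever `v` shares with the
      -- vertices already built lies on `w`.
      · rintro _ ⟨⟨a, ha, m, hm⟩, j, rfl⟩
        rcases hP.eq_or a (hQP ha) v hv m j hm with rfl | ⟨-, h2⟩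
        · exact ⟨m, hmax a ha m hm⟩
        · exact ⟨j, hP.base w hwP v hv j h2⟩
      · exact fun x hx => ⟨w, hwQ, hx⟩

/-! ### The paths of a tree cover -/

/-- The number of vertices strictly above `b` and at most `x`. -/
noncomputable def height {V : Type u} [PartialOrder V] (b x : V) : ℕ :=
  {y : V | b < y ∧ y ≤ x}.ncard

theorem height_eq_zero {V : Type u} [PartialOrder V] {b x : V} (h : x ≤ b) : height b x = 0 := by
  have : {y : V | b < y ∧ y ≤ x} = ∅ :=
    Set.eq_empty_of_forall_notMem fun y hy => (hy.1.trans_le (hy.2.trans h)).false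
  rw [height, this, Set.ncard_empty]

theorem IsForest.le_total {V : Type u} [PartialOrder V] (hV : IsForest V) {x y z : V}
    (hx : x ≤ z) (hy : y ≤ z) : x ≤ y ∨ y ≤ x :=
  (hV z).2.total hx hy

/-- Predecessors of `y` are comparable, and nothing fits between `x` and `y`. In particular lower
covers are unique. -/
theorem IsForest.le_of_lt_covBy {V : Type u} [PartialOrder V] (hV : IsForest V) {x y z : V}
    (hxy : x ⋖ y) (hz : z < y) : z ≤ x := by
  rcases hV.le_total hz.le hxy.le with h | h
  · exact h
  · exact (h.lt_or_eq.resolve_left fun h => hxy.2 h hz).ge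

theorem IsForest.height_covBy {V : Type u} [PartialOrder V] [Finite V] (hV : IsForest V)
    {b x y : V} (hb : b ≤ x) (hxy : x ⋖ y) : height b y = height b x + 1 := by
  have : {z : V | b < z ∧ z ≤ y} = insert y {z : V | b < z ∧ z ≤ x} := by
    ext z
    constructor
    · rintro ⟨h1, h2⟩
      rcases h2.eq_or_lt with h | h
      · exact Or.inl h
      · exact Or.inr ⟨h1, hV.le_of_lt_covBy hxy h⟩
    · rintro (rfl | ⟨h1, h2⟩)
      · exact ⟨hb.trans_lt hxy.lt, le_rfl⟩
      · exact ⟨h1, h2.trans hxy.le⟩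
  rw [height, this, Set.ncard_insert_of_notMem (fun h => hxy.lt.not_ge h.2) (Set.toFinite _)]
  rfl

theorem exists_isLeaf_ge {V : Type u} [PartialOrder V] [Finite V] (x : V) :
    ∃ z, x ≤ z ∧ IsLeaf z := by
  obtain ⟨z, hxz, hz⟩ := Finite.exists_le_maximal (p := fun _ : V => True) (a := x) trivial
  exact ⟨z, hxz, Set.Subset.antisymm (fun y hy => le_antisymm (hz.2 trivial hy) hy)
    fun y hy => hy.ge⟩

/-- A tuple that begins like `u`, and from its `k`-th entry on ascends in cover steps to a leaf. -/
structure IsLeafPath {V : Type u} [PartialOrder V] {k d : ℕ} (u c : Fin (k + d) → V) : Prop where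
  eq : ∀ i : Fin (k + d), (i : ℕ) < k → c i = u i
  cov : ∀ i j : Fin (k + d), k ≤ (i : ℕ) + 1 → (j : ℕ) = (i : ℕ) + 1 → c i ⋖ c j
  leaf : ∀ i : Fin (k + d), (i : ℕ) + 1 = k + d → IsLeaf (c i)

namespace IsLeafPath

variable {V : Type u} [PartialOrder V] {k d : ℕ} {u c c' : Fin (k + d) → V} {b : V}

theorem monotone (hc : IsLeafPath u c) (hu : Monotone u) : Monotone c := by
  have main : ∀ n : ℕ, ∀ i j : Fin (k + d), (j : ℕ) = (i : ℕ) + n → c i ≤ c j := by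
    intro n
    induction n with
    | zero => intro i j h; rw [Fin.ext h]
    | succ n ih =>
      intro i j h
      let m : Fin (k + d) := ⟨(i : ℕ) + n, by omega⟩
      refine (ih i m rfl).trans ?_
      have hj : (j : ℕ) = (m : ℕ) + 1 := h
      by_cases hk : k ≤ (m : ℕ) + 1
      · exact (hc.cov m j hk hj).le
      · rw [hc.eq m (by omega), hc.eq j (by omega)]
        exact hu (by rw [Fin.le_def]; omega)
  intro i j hij
  exact main (j - i) i j (by rw [Fin.le_def] at hij; omega)

theorem base_le (hc : IsLeafPath u c) (hu : Monotone u) (hb : ∀ i : Fin (k + d), (i : ℕ) + 1 = k → u i = b)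
    (hk : 1 ≤ k) {i : Fin (k + d)} (hi : k ≤ (i : ℕ) + 1) : b ≤ c i := by
  let m : Fin (k + d) := ⟨k - 1, by omega⟩
  have hm : (m : ℕ) + 1 = k := Nat.sub_add_cancel hk
  rw [← hb m hm, ← hc.eq m (by omega)]
  exact hc.monotone hu (by rw [Fin.le_def]; omega)

theorem le_base (hc : IsLeafPath u c) (hu : Monotone u) (hb : ∀ i : Fin (k + d), (i : ℕ) + 1 = k → u i = b)
    (hk : 1 ≤ k) {i : Fin (k + d)} (hi : (i : ℕ) < k) : c i ≤ b := by
  let m : Fin (k + d) := ⟨k - 1, by omega⟩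
  have hm : (m : ℕ) + 1 = k := Nat.sub_add_cancel hk
  rw [← hb m hm, hc.eq i hi]
  exact hu (by rw [Fin.le_def]; omega)

/-- The base sits at the zero-based index `k - 1`, and each cover step adds one; truncated
subtraction gives `0` below it. Heights thus recover positions from `k` on, which yields `eq_or`. -/
theorem height_apply [Finite V] (hV : IsForest V) (hc : IsLeafPath u c) (hu : Monotone u)
    (hb : ∀ i : Fin (k + d), (i : ℕ) + 1 = k → u i = b) (hk : 1 ≤ k) (i : Fin (k + d)) :
    height b (c i) = (i : ℕ) + 1 - k := by
  obtain ⟨n, hn⟩ := i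
  induction n with
  | zero => rw [height_eq_zero (hc.le_base hu hb hk (by exact hk))]; exact (Nat.sub_eq_zero_of_le hk).symm
  | succ n ih =>
    by_cases h : n + 1 < k
    · rw [height_eq_zero (hc.le_base hu hb hk h)]
      exact (Nat.sub_eq_zero_of_le h).symm
    · rw [hV.height_covBy (hc.base_le hu hb hk (i := ⟨n, by omega⟩) (not_lt.1 h))
        (hc.cov ⟨n, by omega⟩ _ (not_lt.1 h) rfl), ih]
      change n + 1 - k + 1 = n + 1 + 1 - k
      omega

theorem eq_or [Finite V] (hV : IsForest V) (hc : IsLeafPath u c) (hc' : IsLeafPath u c')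
    (hu : Monotone u) (hb : ∀ i : Fin (k + d), (i : ℕ) + 1 = k → u i = b) (hk : 1 ≤ k) {i j : Fin (k + d)}
    (h : c i = c' j) : i = j ∨ ((i : ℕ) < k ∧ (j : ℕ) < k) := by
  have h1 := hc.height_apply hV hu hb hk i
  have h2 := hc'.height_apply hV hu hb hk j
  rw [h, h2] at h1
  rw [Fin.ext_iff]
  omega

theorem lower (hV : IsForest V) (hc : IsLeafPath u c) (hc' : IsLeafPath u c')
    {i j : Fin (k + d)} (hij : i ≤ j) (h : c j = c' j) : c i = c' i := by
  have main : ∀ n : ℕ, ∀ i j : Fin (k + d), (j : ℕ) = (i : ℕ) + n → c j = c' j → c i = c' i := by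
    intro n
    induction n with
    | zero => intro i j h e; rwa [← Fin.ext h]
    | succ n ih =>
      intro i j h e
      let m : Fin (k + d) := ⟨(i : ℕ) + n, by omega⟩
      refine ih i m rfl ?_
      have hj : (j : ℕ) = (m : ℕ) + 1 := h
      by_cases hk : k ≤ (m : ℕ) + 1
      · have h1 := hc.cov m j hk hj
        have h2 := hc'.cov m j hk hj
        rw [← e] at h2
        exact le_antisymm (hV.le_of_lt_covBy h2 h1.lt) (hV.le_of_lt_covBy h1 h2.lt)
      · rw [hc.eq m (by omega), hc'.eq m (by omega)]
  exact main (j - i) i j (by rw [Fin.le_def] at hij; omega) h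

/-- The vertices of a leaf path form a lower set. -/
theorem exists_apply_eq (hV : IsForest V) (hc : IsLeafPath u c) (hu : Monotone u)
    (hb : ∀ i : Fin (k + d), (i : ℕ) + 1 = k → u i = b) (hk : 1 ≤ k)
    (hlab : ∀ x, ¬ b ≤ x → ∃ i : Fin (k + d), (i : ℕ) < k ∧ u i = x) {y : V} (i : Fin (k + d))
    (hy : y ≤ c i) : ∃ j ≤ i, c j = y := by
  -- Above the base one descends along unique lower covers; elsewhere `y` is one of the first `k`
  -- labels, common to all leaf paths.
  by_cases hby : b ≤ y
  · obtain ⟨n, hn⟩ := i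
    induction n with
    | zero =>
      refine ⟨_, le_rfl, le_antisymm ?_ hy⟩
      exact (hc.le_base hu hb hk (by exact hk)).trans hby
    | succ n ih =>
      by_cases h : n + 1 < k
      · exact ⟨_, le_rfl, le_antisymm ((hc.le_base hu hb hk h).trans hby) hy⟩
      · rcases hy.eq_or_lt with e | hlt
        · exact ⟨_, le_rfl, e.symm⟩
        · obtain ⟨j, hj, e⟩ := ih (by omega) (hV.le_of_lt_covBy
            (hc.cov ⟨n, by omega⟩ _ (not_lt.1 h) rfl) hlt)
          exact ⟨j, hj.trans (Nat.le_succ n), e⟩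
  · obtain ⟨j, hj, rfl⟩ := hlab y hby
    rcases le_total j i with h | h
    · exact ⟨j, h, hc.eq j hj⟩
    · refine ⟨i, le_rfl, le_antisymm ?_ hy⟩
      rw [← hc.eq j hj]
      exact hc.monotone hu h

end IsLeafPath

/-- Every leaf of height `d` over `b` is the end of a leaf path. -/
theorem IsLeaf.exists_isLeafPath {V : Type u} [PartialOrder V] [Finite V] {k d : ℕ}
    {u : Fin (k + d) → V} {b z : V} (hV : IsForest V) (hb : ∀ i : Fin (k + d), (i : ℕ) + 1 = k → u i = b)
    (hk : 1 ≤ k) (hz : IsLeaf z) (hbz : b ≤ z) (hd : height b z = d) :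
    ∃ c : Fin (k + d) → V, IsLeafPath u c ∧ z ∈ Set.range c := by
  obtain ⟨f, hf0, n, hfn, hcov⟩ := exists_covBy_seq_of_wellFoundedLT_wellFoundedGT_of_le hbz
  have hf : ∀ m ≤ n, b ≤ f m ∧ height b (f m) = m := by
    intro m
    induction m with
    | zero => exact fun _ => ⟨hf0.ge, height_eq_zero hf0.le⟩
    | succ m ih =>
      intro hm
      obtain ⟨h1, h2⟩ := ih (by omega)
      have := hcov m hm
      exact ⟨h1.trans this.le, by rw [hV.height_covBy h1 this, h2]⟩
  have hn : n = d := by rw [← (hf n le_rfl).2, hfn, hd]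
  subst hn
  -- At index `k - 1` both branches equal `b`, so one formula covers all cover steps, including the
  -- one leaving the base.
  have happ : ∀ i : Fin (k + n), k ≤ (i : ℕ) + 1 →
      (if (i : ℕ) < k then u i else f (i + 1 - k)) = f (i + 1 - k) := by
    intro i hi
    split_ifs with h
    · rw [hb i (by omega), show (i : ℕ) + 1 - k = 0 by omega, hf0]
    · rfl
  refine ⟨fun i => if (i : ℕ) < k then u i else f (i + 1 - k), ⟨?_, ?_, ?_⟩,
    ⟨⟨k + n - 1, by omega⟩, ?_⟩⟩
  · intro i hi
    exact if_pos hi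
  · intro i j hi hj
    simp only [happ i hi, happ j (by omega)]
    rw [show (j : ℕ) + 1 - k = (i + 1 - k) + 1 by omega]
    exact hcov _ (by omega)
  · intro i hi
    simp only [happ i (by omega)]
    rwa [show (i : ℕ) + 1 - k = n by omega, hfn]
  · refine (happ ⟨k + n - 1, by omega⟩ ?_).trans ?_
    · change k ≤ k + n - 1 + 1
      omega
    · rw [show ((⟨k + n - 1, by omega⟩ : Fin (k + n)) : ℕ) + 1 - k = n by
        change k + n - 1 + 1 - k = n
        omega, hfn]

/-- If `u` and `v` share a label above the base, then so do any two paths, at the same position. -/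
theorem eq_of_gca_le {V : Type u} [PartialOrder V] [Finite V] {k d : ℕ}
    {u v c c' : Fin (k + d) → V} {b : V} (hV : IsForest V) (hu : IsLeafPath u u)
    (hv : IsLeafPath u v) (hc : IsLeafPath u c) (hc' : IsLeafPath u c') (humono : Monotone u)
    (hb : ∀ i : Fin (k + d), (i : ℕ) + 1 = k → u i = b) (hk : 1 ≤ k)
    (hlab : ∀ x, ¬ b ≤ x → ∃ i : Fin (k + d), (i : ℕ) < k ∧ u i = x) {l : Fin (k + d)}
    (hl : (l : ℕ) + 1 = k + d) (hgca : gca b (u l) (v l) ≤ gca b (c l) (c' l))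
    {i : Fin (k + d)} (hi : u i = v i) : c i = c' i := by
  by_cases hik : (i : ℕ) < k
  · rw [hc.eq i hik, hc'.eq i hik]
  by_contra hne
  have hil : i ≤ l := by rw [Fin.le_def]; omega
  -- Counting: agreement of `u` and `v` at `i` forces at least `i + 1 - k` common ancestors, while
  -- `c` and `c'`, differing at `i`, have all theirs at or below position `i - 1`, hence at most `i
  -- - k`.
  let m : Fin (k + d) := ⟨i - 1, by omega⟩
  have h1 : (i : ℕ) + 1 - k ≤ gca b (u l) (v l) := by
    rw [← hu.height_apply hV humono hb hk i]
    refine Set.ncard_le_ncard ?_ (Set.toFinite _)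
    rintro z ⟨hz, hzi⟩
    exact ⟨hz, hzi.trans (humono hil), (hzi.trans hi.le).trans (hv.monotone humono hil)⟩
  have h2 : gca b (c l) (c' l) ≤ (m : ℕ) + 1 - k := by
    rw [← hc.height_apply hV humono hb hk m]
    refine Set.ncard_le_ncard ?_ (Set.toFinite _)
    rintro z ⟨hz, hzc, hzc'⟩
    obtain ⟨j, -, rfl⟩ := hc.exists_apply_eq hV humono hb hk hlab l hzc
    obtain ⟨j', -, e⟩ := hc'.exists_apply_eq hV humono hb hk hlab l hzc'
    refine ⟨hz, hc.monotone humono ?_⟩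
    rcases hc.eq_or hV hc' humono hb hk e.symm with rfl | ⟨hj, -⟩
    · by_contra hlt
      refine hne (hc.lower hV hc' (j := j) ?_ e.symm)
      rw [Fin.le_def] at hlt ⊢
      change ¬ (j : ℕ) ≤ i - 1 at hlt
      omega
    · exact absurd (hz.trans_le (hc.le_base humono hb hk hj)) (lt_irrefl _)
  change _ ≤ (i : ℕ) - 1 + 1 - k at h2
  omega

/-! ### Generation -/

theorem exists_isComposite_of_axioms {k d : ℕ} (hk : 1 ≤ k) (F : Augmented.{u} k d)
    [PartialOrder F.toBilabelled.V] (p : F.toBilabelled.V → Fin (k + 1))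
    (hcover : IsTreeCover F.toBilabelled.graph) (hp : IsPebbling F.toBilabelled.graph p)
    (hF : Axioms hk F p) :
    ∃ X : BilabelledGraph.{0} (k + d) (k + d), IsComposite (some ⟨X, F.pIn, F.pOut⟩) ∧
      F.toBilabelled.Iso X := by
  classical
  have := F.toBilabelled.finite_V
  have := Fintype.ofFinite F.toBilabelled.V
  obtain ⟨⟨hV, -⟩, hedge⟩ := hcover
  obtain ⟨⟨-, -, huleaf, hvleaf⟩, ⟨huv, humono, -⟩, hcov, hunl, hd, hgca, hinj, hpio⟩ := hF
  generalize hG : F.toBilabelled.graph = G at *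
  generalize hu' : F.toBilabelled.inLabel = u at *
  generalize hv' : F.toBilabelled.outLabel = v at *
  generalize hb' : u ⟨k - 1, by omega⟩ = b at *
  have hb : ∀ i : Fin (k + d), (i : ℕ) + 1 = k → u i = b := by
    intro i hi
    rw [← hb']
    exact congrArg u (Fin.ext (by change (i : ℕ) = k - 1; omega))
  have hlast : ∀ i : Fin (k + d), (i : ℕ) + 1 = k + d → i = ⟨k + d - 1, by omega⟩ := by
    intro i hi
    exact Fin.ext (by change (i : ℕ) = k + d - 1; omega)
  have hu : IsLeafPath u u :=
    ⟨fun _ _ => rfl, fun i j hi hj => ⟨(hcov i j hi hj).1.1,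
      fun x h1 h2 => (hcov i j hi hj).1.2 ⟨x, h1, h2⟩⟩, fun i hi => hlast i hi ▸ huleaf⟩
  have hv : IsLeafPath u v :=
    ⟨fun i hi => (huv i hi).symm, fun i j hi hj => ⟨(hcov i j hi hj).2.1,
      fun x h1 h2 => (hcov i j hi hj).2.2 ⟨x, h1, h2⟩⟩, fun i hi => hlast i hi ▸ hvleaf⟩
  have hlab : ∀ x, ¬ b ≤ x → ∃ i : Fin (k + d), (i : ℕ) < k ∧ u i = x := by
    intro x hx
    by_contra hne
    refine hx (hunl x ?_ ?_)
    · rintro ⟨i, rfl⟩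
      by_cases hi : (i : ℕ) < k
      · exact hne ⟨i, hi, rfl⟩
      · exact hx (hu.base_le humono hb hk (by omega))
    · rintro ⟨i, rfl⟩
      by_cases hi : (i : ℕ) < k
      · exact hne ⟨i, hi, huv i hi⟩
      · exact hx (hv.base_le humono hb hk (by omega))
  have hbranch : IsBranching p {c | IsLeafPath u c} := by
    refine ⟨fun c (hc : IsLeafPath u c) =>
        ⟨hc.monotone humono, fun i j => hc.eq_or hV hc humono hb hk, ?_⟩,
      fun c (hc : IsLeafPath u c) c' (hc' : IsLeafPath u c') i hi =>
        (hc.eq i hi).trans (hc'.eq i hi).symm,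
      fun c (hc : IsLeafPath u c) c' hc' i j => hc.eq_or hV hc' humono hb hk,
      fun c (hc : IsLeafPath u c) c' hc' i j => hc.lower hV hc'⟩
    intro i j hi hj
    rw [hc.eq i hi, hc.eq j hj]
    exact hinj i j hi hj
  -- Covering all predecessors of `y` by one path handles vertices and edges together, since the
  -- ends of an edge are comparable.
  have hmem : ∀ y, ∃ c, IsLeafPath u c ∧ ∀ x ≤ y, x ∈ Set.range c := by
    intro y
    have hchain : ∀ c, IsLeafPath u c → y ∈ Set.range c → ∀ x ≤ y, x ∈ Set.range c := by
      rintro c hc ⟨i, rfl⟩ x hx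
      obtain ⟨j, -, e⟩ := hc.exists_apply_eq hV humono hb hk hlab i hx
      exact ⟨j, e⟩
    by_cases hy : b ≤ y
    · obtain ⟨z, hyz, hz⟩ := exists_isLeaf_ge y
      obtain ⟨c, hc, i, rfl⟩ := hz.exists_isLeafPath hV hb hk (hy.trans hyz) (hd z hz)
      obtain ⟨j, -, e⟩ := hc.exists_apply_eq hV humono hb hk hlab i hyz
      exact ⟨c, hc, hchain c hc ⟨j, e⟩⟩
    · obtain ⟨i, -, e⟩ := hlab y hy
      exact ⟨u, hu, hchain u hu ⟨i, e⟩⟩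
  let P : Finset (Fin (k + d) → F.toBilabelled.V) := Finset.univ.filter (IsLeafPath u)
  have hPmem : ∀ c, c ∈ P ↔ IsLeafPath u c := by simp [P]
  have hP : (P : Set (Fin (k + d) → F.toBilabelled.V)) = {c | IsLeafPath u c} := by
    ext c
    exact hPmem c
  have hob := IsBranching.obtainable hp P (hP ▸ hbranch) ((hPmem u).2 hu) ((hPmem v).2 hv) (by
    intro i hi c hc c' hc'
    have hc := (hPmem c).1 hc
    have hc' := (hPmem c').1 hc'
    have hl : ((⟨k + d - 1, by omega⟩ : Fin (k + d)) : ℕ) + 1 = k + d := by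
      change k + d - 1 + 1 = k + d
      omega
    exact eq_of_gca_le hV hu hv hc hc' humono hb hk hlab hl
      (hgca _ _ (hc.leaf _ hl) (hc'.leaf _ hl)) hi)
  have hvert : vertices {c | IsLeafPath u c} = Set.univ := by
    refine Set.eq_univ_of_forall fun x => ?_
    obtain ⟨c, hc, h⟩ := hmem x
    exact ⟨c, hc, h x le_rfl⟩
  have hgraph : graphOn G {c | IsLeafPath u c} = G := by
    ext x y
    refine ⟨fun h => h.1, fun h => ⟨h, ?_⟩⟩
    rcases hedge x y h with hxy | hxy
    · obtain ⟨c, hc, h⟩ := hmem y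
      exact ⟨c, hc, h x hxy, h y le_rfl⟩
    · obtain ⟨c, hc, h⟩ := hmem x
      exact ⟨c, hc, h x le_rfl, h y hxy⟩
  rw [hP, hvert, hgraph] at hob
  obtain ⟨X, hX, hr⟩ := hob
  refine ⟨X, ?_, Realizes.iso (by rwa [hG, hu', hv'])⟩
  rwa [show F.pIn = p ∘ u from funext fun i => (hpio i).1,
    show F.pOut = p ∘ v from funext fun i => (hpio i).2]

/-- The symbol `⊥` is a product of two identity graphs with different pebbles. -/
theorem isComposite_none {k d : ℕ} (hk : 1 ≤ k) : IsComposite (none : Elem.{0} k d) := by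
  -- A constant pebbling is compatible only if the first `k` labels share one vertex, hence the
  -- constant tuple. As `k ≥ 1`, there are two distinct pebbles to choose from.
  have hgen : ∀ q : Fin (k + 1), IsGenerator (some
      ⟨chainGraph (d := d) (Set.rangeFactorization fun _ : Fin k => (⟨0, hk⟩ : Fin k)) ⊥,
        fun _ => q, fun _ => q⟩) := by
    intro q
    refine IsGenerator.identity _ _ (fun _ _ _ => le_rfl)
      Set.rangeFactorization_surjective _ (fun _ _ => ?_)
    exact iff_of_true rfl rfl
  have hne : (fun _ : Fin (k + d) => (0 : Fin (k + 1))) ≠ fun _ => Fin.last k := by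
    intro h
    have := congrArg Fin.val (congrFun h ⟨0, by omega⟩)
    simp at this
    omega
  have := (hgen 0).isComposite.series (hgen (Fin.last k))
  simpa [PebbleWL.series, hne] using this

end PebbleWL

theorem mainTheorem9 (k d : ℕ) (hk : 1 ≤ k) (F : PebbleWL.Elem.{u} k d)
    (hF : F ∈ PebbleWL.WL k d hk) :
    ∃ (A : PebbleWL.Elem.{0} k d) (L : List (PebbleWL.Elem.{0} k d)),
      A ∈ PebbleWL.generators k d ∧ (∀ B ∈ L, B ∈ PebbleWL.generators k d) ∧
      PebbleWL.Same F (L.foldl PebbleWL.series A) := by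
  rcases hF with rfl | ⟨F, rfl, _, p, hcover, hp, hax⟩
  · obtain ⟨A, L, hA, hL, h⟩ := PebbleWL.isComposite_none (d := d) hk
    exact ⟨A, L, hA, hL, by rw [h]; trivial⟩
  · obtain ⟨X, ⟨A, L, hA, hL, h⟩, hiso⟩ :=
      PebbleWL.exists_isComposite_of_axioms hk F p hcover hp hax
    exact ⟨A, L, hA, hL, by rw [h]; exact ⟨hiso, rfl, rfl⟩⟩
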